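/- Let $T$ be an infinite locally finite rooted tree with boundary $\partial T$ (the space of infinite geodesic rays from the root, with its profinite topology), let $\mathrm{Aut}(T)$ be the group of root-preserving automorphisms of $T$, and for a vertex $v$ let $T_v$ be the subtree of vertices below $v$ (including $v$) and $\partial T_v\subset\partial T$ the set of rays through $v$. Let $G\le \mathrm{Aut}(T)$ be a weakly branch group, that is: $G$ acts transitively on every level of $T$ (so $T$ is spherically homogeneous), and the action of $G$ on $\partial T$ is micro-supported, i.e. for every non-empty open $U\subseteq\partial T$ the subgroup of $G$ fixing $\partial T\setminus U$ pointwise is non-trivial. For a vertex $v$, write $\mathrm{rist}_G(v)$ for the subgroup of $G$ fixing $\partial T\setminus\partial T_v$ pointwise, and $\mathrm{rist}_G(v)'$ for its derived subgroup; for $H\le G$ let $\mathrm{Fix}(H)\subseteq\partial T$ be the closed set of its fixed points. Let $\mathcal F(\partial T)$ be the space of closed subsets of $\partial T$ (including $\varnothing$), with the topology generated by the sets $\{C : C\cap K=\varnothing\}$ ($K$ compact) and $\{C : C\cap U\neq\varnothing\}$ ($U$ open). Let $\Pi(T)$ be the set of all sets $\mathcal V$ of vertices of $T$ such that $T_v\cap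 T_w=\varnothing$ for all distinct $v,w\in\mathcal V$, with the topology induced from the product topology on the power set of the vertex set, and let $\pi_\perp:\Pi(T)\to\mathcal F(\partial T)$, $\pi_\perp(\mathcal V)=\partial T\setminus\bigsqcup_{v\in\mathcal V}\partial T_v$. The group $G$ acts naturally on $\mathcal F(\partial T)$ and on $\Pi(T)$. Let $X$ be a compact (not necessarily Hausdorff) space on which $G$ acts minimally by homeomorphisms, and let $\Phi: X\to\mathrm{Sub}(G)$ be a map into the set of subgroups of $G$ that is $G$-equivariant, $\Phi(gx)=g\Phi(x)g^{-1}$, and lower semi-continuous: for every subset $U\subseteq G$ the set $\{x\in X : \Phi(x)\cap U\ne\varnothing\}$ is open. Then: (i) The map $\Psi: X\to\mathcal F(\partial T)$, $x\mapsto\mathrm{Fix}(\Phi(x))$, is continuous. (ii) Let $F_X\subseteq\mathcal F(\partial T)$ be the image of $\Psi$, which is $G$-invariant. There is a continuous $G$-equivariant map $\sigma: F_X\to\Pi(T)$ such that (a) $\pi_\perp\circ\sigma=\mathrm{id}_{F_X}$, and (b) for every $x\in X$ and every $v\in\sigma(\mathrm{Fix}(\Phi(x)))$ one has $\mathrm{rist}_G(v)'\le\Phi(x)$.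 -/

import Mathlib

open TopologicalSpace

universe u v

namespace TreeAction

section Tree

/- Throughout, rooted trees are represented by Mathlib's `RootedTree`: the vertex set with the
ancestor order, in which `⊥` is the root, `v ⋖ w` means that `w` is a child of `v` (so `⋖` is the
edge relation, oriented away from the root), and `v ≤ w` means that `w` is below `v`, i.e. that the
geodesic from the root to `w` passes through `v`.  The graph automorphisms that fix the root are
exactly the order automorphisms `T ≃o T`. -/

variable (T : RootedTree.{u})

/-- Every vertex has finitely many children. -/
def LocallyFinite : Prop :=
  ∀ v : T, {w : T | v ⋖ w}.Finite

/-- The `n`-th level: the vertices at distance `n` from the root. -/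
def level : ℕ → Set T
  | 0 => {⊥}
  | n + 1 => {w | ∃ v ∈ level n, v ⋖ w}

/-- The boundary `∂T`: the infinite geodesic rays starting at the root. -/
@[ext]
structure Boundary : Type u where
  vertex : ℕ → T
  vertex_zero : vertex 0 = ⊥
  vertex_covBy : ∀ n, vertex n ⋖ vertex (n + 1)

/-- The topology of `∂T`, inherited from the product of the discrete vertex sets. -/
instance : TopologicalSpace (Boundary T) :=
  TopologicalSpace.induced (fun ξ => ξ.vertex) (@Pi.topologicalSpace ℕ (fun _ => T) fun _ => ⊥)

variable {T}

/-- The cylinder `∂T_v`: the rays passing through the vertex `v`. -/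
def cylinder (v : T) : Set (Boundary T) :=
  {ξ | ∃ n, ξ.vertex n = v}

theorem continuous_coord (n : ℕ) :
    @Continuous (Boundary T) T _ ⊥ (fun ξ => ξ.vertex n) := by
  let : TopologicalSpace T := ⊥
  have h : Continuous (fun ξ : Boundary T => ξ.vertex) := continuous_induced_dom
  exact (continuous_apply n).comp h

theorem isOpen_coord_eq (n : ℕ) (v : T) : IsOpen {ξ : Boundary T | ξ.vertex n = v} := by
  let : TopologicalSpace T := ⊥
  have : DiscreteTopology T := ⟨rfl⟩
  exact (isOpen_discrete ({v} : Set T)).preimage (continuous_coord n)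

theorem isOpen_cylinder (v : T) : IsOpen (cylinder v) := by
  have h : cylinder v = ⋃ n, {ξ : Boundary T | ξ.vertex n = v} := by
    ext ξ
    simp [cylinder]
  rw [h]
  exact isOpen_iUnion fun n => isOpen_coord_eq n v

instance : T2Space (Boundary T) := by
  let : TopologicalSpace T := ⊥
  have : DiscreteTopology T := ⟨rfl⟩
  have h : Continuous (fun ξ : Boundary T => ξ.vertex) := continuous_induced_dom
  exact T2Space.of_injective_continuous (fun _ _ => Boundary.ext) h

/-- `Aut(T)` acts on `∂T` by moving the vertices of a ray. -/
instance : MulAction (T ≃o T) (Boundary T) where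
  smul g ξ := {
    vertex := fun n => g (ξ.vertex n)
    vertex_zero := by rw [ξ.vertex_zero, map_bot]
    vertex_covBy := fun n => (apply_covBy_apply_iff g).2 (ξ.vertex_covBy n) }
  one_smul _ := rfl
  mul_smul _ _ _ := rfl

theorem smul_boundary_apply (g : T ≃o T) (ξ : Boundary T) (n : ℕ) : (g • ξ).vertex n = g (ξ.vertex n) := rfl

instance : ContinuousConstSMul (T ≃o T) (Boundary T) where
  continuous_const_smul g := by
    let : TopologicalSpace T := ⊥
    have : DiscreteTopology T := ⟨rfl⟩
    refine continuous_induced_rng.2 (continuous_pi fun n => ?_)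
    have hg : Continuous (fun v : T => g v) := continuous_of_discreteTopology
    exact hg.comp (continuous_coord n)

end Tree

section ClosedSets

/-- The topology of the space `F(Y)` of closed subsets of `Y`, generated by the sets
`{C | C ∩ K = ∅}` for `K` compact and `{C | C ∩ U ≠ ∅}` for `U` open. -/
@[reducible]
def closedsTopology (Y : Type u) [TopologicalSpace Y] : TopologicalSpace (Closeds Y) :=
  TopologicalSpace.generateFrom
    ({S | ∃ K : Set Y, IsCompact K ∧ S = {C : Closeds Y | (C : Set Y) ∩ K = ∅}} ∪
      {S | ∃ U : Set Y, IsOpen U ∧ S = {C : Closeds Y | ((C : Set Y) ∩ U).Nonempty}})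

instance (T : RootedTree.{u}) : TopologicalSpace (Closeds (Boundary T)) :=
  closedsTopology (Boundary T)

/-- `Aut(T)` acts on the closed subsets of `∂T` by taking images. -/
instance (T : RootedTree.{u}) : MulAction (T ≃o T) (Closeds (Boundary T)) where
  smul g C := ⟨(fun ξ => g • ξ) '' (C : Set (Boundary T)),
    (Homeomorph.smul g).isClosedMap _ C.isClosed⟩
  one_smul C := by
    apply Closeds.ext
    change (fun ξ : Boundary T => (1 : T ≃o T) • ξ) '' (C : Set (Boundary T)) = C
    simp
  mul_smul g h C := by
    apply Closeds.ext
    change (fun ξ : Boundary T => (g * h) • ξ) '' (C : Set (Boundary T)) =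
      (fun ξ => g • ξ) '' ((fun ξ => h • ξ) '' (C : Set (Boundary T)))
    rw [Set.image_image]
    simp only [mul_smul]

end ClosedSets

section Antichains

/-- The space `Π(T)` of sets of pairwise independent vertices, where `v` and `w` are independent
if the subtrees `T_v` and `T_w` are disjoint. -/
@[ext]
structure Antichains (T : RootedTree.{u}) : Type u where
  verts : Set T
  independent : verts.Pairwise fun v w => Disjoint (Set.Ici v) (Set.Ici w)

/-- The topology induced by the product topology on the power set `{0,1}^T`, with discrete
factors. -/
instance (T : RootedTree.{u}) : TopologicalSpace (Antichains T) :=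
  TopologicalSpace.induced (fun V v => v ∈ V.verts)
    (@Pi.topologicalSpace T (fun _ => Prop) fun _ => ⊥)

/-- `Aut(T)` acts on `Π(T)` by taking images. -/
instance (T : RootedTree.{u}) : MulAction (T ≃o T) (Antichains T) where
  smul g V := {
    verts := g '' V.verts
    independent := by
      rintro _ ⟨v, hv, rfl⟩ _ ⟨w, hw, rfl⟩ hvw
      have h : Disjoint (Set.Ici v) (Set.Ici w) :=
        V.independent hv hw (fun e => hvw (by rw [e]))
      rw [Set.disjoint_left] at h ⊢
      intro a ha hb
      exact h (a := g.symm a) ((OrderIso.le_symm_apply g).2 ha)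
        ((OrderIso.le_symm_apply g).2 hb) }
  one_smul V := by
    apply Antichains.ext
    change (fun v : T => v) '' V.verts = V.verts
    simp
  mul_smul g h V := by
    apply Antichains.ext
    change (fun v : T => g (h v)) '' V.verts = g '' (h '' V.verts)
    rw [Set.image_image]

/-- The map `π_⊥ : Π(T) → F(∂T)`, sending `V` to the complement of the union of the cylinders
`∂T_v`, `v ∈ V`. -/
def piPerp {T : RootedTree.{u}} (V : Antichains T) : Closeds (Boundary T) :=
  ⟨(⋃ v ∈ V.verts, cylinder v)ᶜ, (isOpen_biUnion fun v _ => isOpen_cylinder v).isClosed_compl⟩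

end Antichains

section Groups

/-- The rigid stabilizer of a subset `U` of a `G`-set: the elements that fix every point outside
`U`. -/
def rigidStabilizer (G : Type u) {Y : Type v} [Group G] [MulAction G Y] (U : Set Y) : Subgroup G :=
  fixingSubgroup G Uᶜ

/-- A group action on a space is micro-supported if the rigid stabilizers of the non-empty open
subsets are all non-trivial. -/
def MicroSupported (G : Type u) (Y : Type v) [Group G] [TopologicalSpace Y] [MulAction G Y] :
    Prop :=
  ∀ U : Set Y, IsOpen U → U.Nonempty → rigidStabilizer G U ≠ ⊥

variable {T : RootedTree.{u}}

/-- `G ≤ Aut(T)` acts transitively on every level. -/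
def LevelTransitive (G : Subgroup (T ≃o T)) : Prop :=
  ∀ n, ∀ v ∈ level T n, ∀ w ∈ level T n, ∃ g ∈ G, g v = w

/-- `G ≤ Aut(T)` is weakly branch: `T` is an infinite locally finite rooted tree and `G` is
level-transitive (so that `T` is spherically homogeneous) with micro-supported action on `∂T`. -/
structure IsWeaklyBranch (G : Subgroup (T ≃o T)) : Prop where
  locallyFinite : LocallyFinite T
  infinite : Infinite T
  levelTransitive : LevelTransitive G
  microSupported : MicroSupported G (Boundary T)

/-- `rist_G(v)`, the rigid stabilizer in `G` of the cylinder `∂T_v`. -/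
def rist (G : Subgroup (T ≃o T)) (v : T) : Subgroup G :=
  rigidStabilizer G (cylinder v)

/-- The set `Fix(H)` of fixed points in `∂T` of a subgroup `H` of `G`. -/
def fix {G : Subgroup (T ≃o T)} (H : Subgroup G) : Closeds (Boundary T) :=
  ⟨{ξ | ∀ h ∈ H, h • ξ = ξ}, by
    simp only [Set.ofPred_forall]
    exact isClosed_iInter fun h => isClosed_iInter fun _ =>
      isClosed_eq (continuous_const_smul (h : T ≃o T)) continuous_id⟩

/-- Lower semi-continuity of a map `X → Sub(G)`, where `G` is discrete: for every (open) subset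
`U` of `G`, the set of `x` such that `Φ x` meets `U` is open. -/
def LowerSemicontinuousSub {G : Type u} [Group G] {X : Type v} [TopologicalSpace X]
    (Φ : X → Subgroup G) : Prop :=
  ∀ U : Set G, IsOpen {x | ((Φ x : Set G) ∩ U).Nonempty}

/-- Equivariance of a map `X → Sub(G)`, where `G` acts on its subgroups by conjugation:
`Φ (g x) = g Φ(x) g⁻¹`. -/
def ConjEquivariant {G : Type u} [Group G] {X : Type v} [MulAction G X]
    (Φ : X → Subgroup G) : Prop :=
  ∀ (g : G) (x : X), Φ (g • x) = (Φ x).map (MulAut.conj g).toMonoidHom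

end Groups

end TreeAction

/-!
The proof rests on two facts about a point `x` and a vertex `v` of level `n`.

*Local constancy.*  Let `p x v` be an equivariant relation which is open in `x` for each `v`.  On the
finite level `n`, the set of vertices with `p x v` can only grow under small perturbations of `x`, so
"at least `k` vertices" is an open invariant condition on `x`.  By minimality the number of vertices
is constant, and hence the set itself is locally constant (`isClosed_of_equivariant`).  For the
relation "the cylinder of `v` contains no fixed point of `Φ x`" this is the continuity of
`x ↦ fix (Φ x)`.  For the relation "`Φ x` moves `v`" it says that the points `x` with this property
form a closed, hence compact, set; it is preserved by the stabilizer of `v`.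

*The commutator lemma.*  By this compactness there is a finite set `P` of elements moving `v` such
that `Φ x` meets `P` whenever `Φ x` moves `v`.  Hence, for each `γ ∈ rist G v`, the subgroup
`H = Φ x` contains `γ * p * γ⁻¹` for some `p ∈ P`.  Elements of rigid stabilizers have arbitrarily
long orbits, which yields a vertex `w` below `v` and finitely many pairs `p, q` such that `w`, `p w`,
`q w` are distinct and, for each `γ ∈ rist G w`, the `γ`-conjugates of both members of some pair lie
in `H`.  By the pigeonhole principle among the powers of `g ∈ rist G w`, the subgroup `H` contains
`g ^ n * e` with `e` supported on `p w`, and another such product with `e` supported on `q w`, where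
`n` depends only on the number of pairs.  Choosing error terms with disjoint supports for two
elements `g`, `k` shows that `⁅g ^ n, k ^ n⁆ ∈ H` (`commutator_pow_mem`).  These commutators are not
all trivial, and their set is invariant under conjugation by the stabilizer of `w`, which is
transitive on the levels below `w`.  So on some level all vertices `u` below `w` are moved by such
commutators, and the double commutator trick gives `⁅rist G u, rist G u⁆ ≤ H`.  All choices are
independent of `x`, and the stabilizer of `v` spreads the conclusion to all deep vertices below `v`
(`exists_level_of_moves`).

A further compactness argument replaces "`Φ x` moves `v`" by "the cylinder of `v` contains no fixed
point of `Φ x`", and provides a function `f` such that it suffices to descend from level `n` to level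
`f n` (`exists_level_function`).  The map `σ` sends a closed set `C` to the set of descendants on
level `f n` of the vertices on level `n`, for all `n`, that are minimal with cylinder disjoint from
`C` (`refinedComplement`).  Membership of a vertex in this set depends on finitely many conditions of
the form "`C` is disjoint from the cylinder of `w`", each of which is clopen.
-/

namespace TreeAction

/-! ### Levels and rays of a rooted tree -/

section Levels

variable {T : RootedTree.{u}}

theorem le_of_lt_of_covBy {u v w : T} (h : u < w) (hvw : v ⋖ w) : u ≤ v := by
  rw [← hvw.pred_eq]
  exact Order.le_pred_of_lt h

theorem exists_mem_level (v : T) : ∃ n, v ∈ level T n := by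
  have key : ∀ (k : ℕ) (w : T), Order.pred^[k] w = ⊥ → ∃ n, w ∈ level T n := by
    intro k
    induction k with
    | zero => exact fun w hw => ⟨0, hw⟩
    | succ k ih =>
      intro w hw
      by_cases hb : w = ⊥
      · exact ⟨0, hb⟩
      · obtain ⟨n, hn⟩ := ih (Order.pred w) hw
        exact ⟨n + 1, Order.pred w, hn, Order.pred_covBy_of_not_isMin (by rwa [isMin_iff_eq_bot])⟩
  obtain ⟨k, hk⟩ := (bot_le (a := v)).exists_pred_iterate
  exact key k v hk

theorem exists_mem_level_of_le {n : ℕ} {u v : T} (hv : v ∈ level T n) (h : u ≤ v) :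
    ∃ m ≤ n, u ∈ level T m := by
  induction n generalizing v with
  | zero =>
    obtain rfl : v = ⊥ := hv
    exact ⟨0, le_rfl, le_bot_iff.1 h⟩
  | succ n ih =>
    rcases h.eq_or_lt with rfl | h
    · exact ⟨n + 1, le_rfl, hv⟩
    · obtain ⟨p, hp, hpv⟩ := hv
      obtain ⟨m, hm, hu⟩ := ih hp (le_of_lt_of_covBy h hpv)
      exact ⟨m, hm.trans n.le_succ, hu⟩

theorem level_eq {n m : ℕ} {v : T} (hn : v ∈ level T n) (hm : v ∈ level T m) : n = m := by
  induction n generalizing m v with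
  | zero =>
    cases m with
    | zero => rfl
    | succ m =>
      obtain ⟨p, -, hp⟩ := hm
      obtain rfl : v = ⊥ := hn
      exact absurd hp.lt not_lt_bot
  | succ n ih =>
    obtain ⟨p, hp, hpv⟩ := hn
    cases m with
    | zero =>
      obtain rfl : v = ⊥ := hm
      exact absurd hpv.lt not_lt_bot
    | succ m =>
      obtain ⟨q, hq, hqv⟩ := hm
      rw [← hqv.pred_eq, hpv.pred_eq] at hq
      rw [ih hp hq]

theorem level_le_of_le {n m : ℕ} {u v : T} (hu : u ∈ level T m) (hv : v ∈ level T n) (h : u ≤ v) :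
    m ≤ n := by
  obtain ⟨k, hk, hk'⟩ := exists_mem_level_of_le hv h
  rwa [level_eq hu hk']

theorem eq_of_le_of_mem_level {n : ℕ} {u v : T} (hu : u ∈ level T n) (hv : v ∈ level T n)
    (h : u ≤ v) : u = v := by
  cases n with
  | zero => exact hu.trans hv.symm
  | succ n =>
    by_contra hne
    obtain ⟨p, hp, hpv⟩ := hv
    have := level_le_of_le hu hp (le_of_lt_of_covBy (lt_of_le_of_ne h hne) hpv)
    omega

theorem le_total_of_le {u v w : T} (hu : u ≤ w) (hv : v ≤ w) : u ≤ v ∨ v ≤ u := by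
  obtain ⟨n, hn⟩ := exists_mem_level w
  induction n generalizing w with
  | zero =>
    obtain rfl : w = ⊥ := hn
    exact Or.inl ((le_bot_iff.1 hu).trans_le bot_le)
  | succ n ih =>
    rcases hu.eq_or_lt with rfl | hu'
    · exact Or.inr hv
    rcases hv.eq_or_lt with rfl | hv'
    · exact Or.inl hu
    obtain ⟨p, hp, hpw⟩ := hn
    exact ih (le_of_lt_of_covBy hu' hpw) (le_of_lt_of_covBy hv' hpw) hp

theorem le_of_le_of_mem_level {n m : ℕ} {u v w : T} (hu : u ∈ level T m) (hv : v ∈ level T n)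
    (hmn : m ≤ n) (huw : u ≤ w) (hvw : v ≤ w) : u ≤ v := by
  rcases le_total_of_le huw hvw with h | h
  · exact h
  · obtain rfl := hmn.antisymm (level_le_of_le hv hu h)
    exact (eq_of_le_of_mem_level hv hu h).ge

theorem eq_of_le_of_le_of_mem_level {n : ℕ} {u v w : T} (hu : u ∈ level T n) (hv : v ∈ level T n)
    (huw : u ≤ w) (hvw : v ≤ w) : u = v :=
  eq_of_le_of_mem_level hu hv (le_of_le_of_mem_level hu hv le_rfl huw hvw)

theorem exists_ancestor {n m : ℕ} {v : T} (hv : v ∈ level T n) (hm : m ≤ n) :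
    ∃ u ∈ level T m, u ≤ v := by
  induction n generalizing v with
  | zero => exact ⟨v, by rwa [Nat.le_zero.1 hm], le_rfl⟩
  | succ n ih =>
    rcases Nat.le_succ_iff.1 hm with h | rfl
    · obtain ⟨p, hp, hpv⟩ := hv
      obtain ⟨u, hu, hup⟩ := ih hp h
      exact ⟨u, hu, hup.trans hpv.le⟩
    · exact ⟨v, hv, le_rfl⟩

theorem apply_mem_level (g : T ≃o T) {n : ℕ} {v : T} (hv : v ∈ level T n) : g v ∈ level T n := by
  induction n generalizing v with
  | zero =>
    obtain rfl : v = ⊥ := hv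
    exact map_bot g
  | succ n ih =>
    obtain ⟨p, hp, hpv⟩ := hv
    exact ⟨g p, ih hp, (apply_covBy_apply_iff g).2 hpv⟩

/-- Automorphisms preserve levels, so a vertex and its image on a common ray coincide. -/
theorem apply_eq_of_apply_le (g : T ≃o T) {v w : T} (hv : v ≤ w) (hgv : g v ≤ w) : g v = v := by
  obtain ⟨n, hn⟩ := exists_mem_level v
  exact eq_of_le_of_le_of_mem_level (apply_mem_level g hn) hn hgv hv

theorem apply_eq_of_le (g : T ≃o T) {v w : T} (hv : v ≤ w) (hw : g w = w) : g v = v :=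
  apply_eq_of_apply_le g hv ((g.monotone hv).trans hw.le)

theorem finite_level (hT : LocallyFinite T) (n : ℕ) : (level T n).Finite := by
  induction n with
  | zero => exact Set.finite_singleton _
  | succ n ih =>
    refine (ih.biUnion fun v _ => hT v).subset ?_
    rintro w ⟨v, hv, hvw⟩
    exact Set.mem_biUnion hv hvw

theorem Boundary.vertex_mem_level (ξ : Boundary T) (n : ℕ) : ξ.vertex n ∈ level T n := by
  induction n with
  | zero => exact ξ.vertex_zero
  | succ n ih => exact ⟨_, ih, ξ.vertex_covBy n⟩

theorem Boundary.monotone_vertex (ξ : Boundary T) : Monotone ξ.vertex :=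
  monotone_nat_of_le_succ fun n => (ξ.vertex_covBy n).le

theorem Boundary.vertex_eq_of_le (ξ : Boundary T) {n m : ℕ} {v : T} (hv : v ∈ level T n)
    (h : v ≤ ξ.vertex m) : ξ.vertex n = v :=
  eq_of_le_of_le_of_mem_level (ξ.vertex_mem_level n) hv
    (ξ.monotone_vertex (le_max_left n m)) (h.trans (ξ.monotone_vertex (le_max_right n m)))

theorem mem_cylinder_iff_le {ξ : Boundary T} {v : T} : ξ ∈ cylinder v ↔ ∃ n, v ≤ ξ.vertex n := by
  constructor
  · rintro ⟨n, rfl⟩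
    exact ⟨n, le_rfl⟩
  · rintro ⟨m, hm⟩
    obtain ⟨n, hn⟩ := exists_mem_level v
    exact ⟨n, ξ.vertex_eq_of_le hn hm⟩

theorem mem_cylinder_iff {ξ : Boundary T} {n : ℕ} {v : T} (hv : v ∈ level T n) :
    ξ ∈ cylinder v ↔ ξ.vertex n = v :=
  ⟨fun ⟨_, hm⟩ => ξ.vertex_eq_of_le hv hm.ge, fun h => ⟨n, h⟩⟩

theorem cylinder_anti {v w : T} (h : v ≤ w) : cylinder w ⊆ cylinder v := by
  rintro ξ ⟨n, rfl⟩
  exact mem_cylinder_iff_le.2 ⟨n, h⟩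

theorem smul_mem_cylinder_iff (g : T ≃o T) (ξ : Boundary T) (v : T) :
    g • ξ ∈ cylinder (g v) ↔ ξ ∈ cylinder v := by
  simp [cylinder, smul_boundary_apply]

theorem exists_cylinder_subset {ξ : Boundary T} {U : Set (Boundary T)} (hU : IsOpen U)
    (hξ : ξ ∈ U) : ∃ n, cylinder (ξ.vertex n) ⊆ U := by
  let : TopologicalSpace T := ⊥
  have : DiscreteTopology T := ⟨rfl⟩
  obtain ⟨V, hV, rfl⟩ := isOpen_induced_iff.1 hU
  obtain ⟨I, t, ht, hsub⟩ := isOpen_pi_iff.1 hV _ hξ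
  refine ⟨I.sup id, fun η hη => hsub fun i hi => ?_⟩
  have h : η.vertex i = ξ.vertex i := by
    rw [mem_cylinder_iff (ξ.vertex_mem_level _)] at hη
    refine η.vertex_eq_of_le (ξ.vertex_mem_level i) (m := I.sup id) ?_
    rw [hη]
    exact ξ.monotone_vertex (Finset.le_sup (f := id) hi)
  change η.vertex i ∈ t i
  rw [h]
  exact (ht i hi).2

theorem compactSpace_boundary (hT : LocallyFinite T) : CompactSpace (Boundary T) := by
  let : TopologicalSpace T := ⊥
  have : DiscreteTopology T := ⟨rfl⟩
  have hind : Topology.IsInducing (fun ξ : Boundary T => ξ.vertex) := ⟨rfl⟩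
  have hrange : Set.range (fun ξ : Boundary T => ξ.vertex) =
      {s : ℕ → T | s 0 = ⊥} ∩ ⋂ n, {s : ℕ → T | s n ⋖ s (n + 1)} := by
    ext s
    simp only [Set.mem_range, Set.mem_inter_iff, Set.mem_iInter]
    constructor
    · rintro ⟨ξ, rfl⟩
      exact ⟨ξ.vertex_zero, ξ.vertex_covBy⟩
    · rintro ⟨h0, h1⟩
      exact ⟨⟨s, h0, h1⟩, rfl⟩
  have hclosed : IsClosed (Set.range (fun ξ : Boundary T => ξ.vertex)) := by
    rw [hrange]
    refine IsClosed.inter ?_ (isClosed_iInter fun n => ?_)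
    · exact (isClosed_discrete ({⊥} : Set T)).preimage
        (continuous_apply 0 : Continuous fun s : ℕ → T => s 0)
    · have hcont : Continuous fun s : ℕ → T => (s n, s (n + 1)) := by fun_prop
      exact (isClosed_discrete {p : T × T | p.1 ⋖ p.2}).preimage hcont
  -- The boundary is a closed subset of the product of the levels.
  have hcpt : IsCompact (Set.range (fun ξ : Boundary T => ξ.vertex)) := by
    refine (isCompact_univ_pi fun n => (finite_level hT n).isCompact).of_isClosed_subset hclosed ?_
    rintro _ ⟨ξ, rfl⟩ n -
    exact ξ.vertex_mem_level n
  exact ⟨hind.isCompact_iff.2 (by rwa [Set.image_univ])⟩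

theorem isClosed_cylinder (v : T) : IsClosed (cylinder v) := by
  let : TopologicalSpace T := ⊥
  have : DiscreteTopology T := ⟨rfl⟩
  obtain ⟨n, hn⟩ := exists_mem_level v
  have h : cylinder v = (fun ξ : Boundary T => ξ.vertex n) ⁻¹' {v} := by
    ext ξ
    exact mem_cylinder_iff hn
  rw [h]
  exact (isClosed_discrete _).preimage (continuous_coord n)

theorem isCompact_cylinder (hT : LocallyFinite T) (v : T) : IsCompact (cylinder v) :=
  have := compactSpace_boundary hT
  (isClosed_cylinder v).isCompact

/-- There are no leaves: by level-transitivity a leaf would bound the levels, and the tree would be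
finite. -/
theorem exists_covBy {G : Subgroup (T ≃o T)} (hT : LocallyFinite T) [Infinite T]
    (hG : LevelTransitive G) (v : T) : ∃ w, v ⋖ w := by
  by_contra! hv
  obtain ⟨n, hn⟩ := exists_mem_level v
  have hempty : level T (n + 1) = ∅ := by
    rw [Set.eq_empty_iff_forall_notMem]
    rintro w ⟨p, hp, hpw⟩
    obtain ⟨g, -, hg⟩ := hG n p hp v hn
    exact hv (g w) (hg ▸ (apply_covBy_apply_iff g).2 hpw)
  have hfin : (⋃ m ∈ Set.Iic n, level T m).Finite :=
    (Set.finite_Iic n).biUnion fun m _ => finite_level hT m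
  refine Set.infinite_univ (hfin.subset fun w _ => ?_)
  obtain ⟨m, hm⟩ := exists_mem_level w
  refine Set.mem_biUnion (x := m) ?_ hm
  by_contra hmn
  obtain ⟨u, hu, -⟩ := exists_ancestor (m := n + 1) hm (by simpa using hmn)
  simp [hempty] at hu

/-- In a tree without leaves there is a ray through each vertex: its vertex of level `m` is the
ancestor of the `m`-th term of a sequence of descendants. -/
theorem nonempty_cylinder (hT : ∀ v : T, ∃ w, v ⋖ w) (v : T) : (cylinder v).Nonempty := by
  choose c hc using hT
  obtain ⟨n, hn⟩ := exists_mem_level v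
  have hs : ∀ k, c^[k] v ∈ level T (n + k) := by
    intro k
    induction k with
    | zero => exact hn
    | succ k ih =>
      rw [Function.iterate_succ_apply']
      exact ⟨_, ih, hc _⟩
  have hmono : Monotone fun k => c^[k] v := by
    refine monotone_nat_of_le_succ fun k => ?_
    rw [Function.iterate_succ_apply']
    exact (hc _).le
  choose a ha hac using fun m => exists_ancestor (hs m) (Nat.le_add_left m n)
  refine ⟨⟨a, ha 0, fun m => ?_⟩, n, ?_⟩
  · obtain ⟨p, hp, hpa⟩ := ha (m + 1)
    rwa [eq_of_le_of_le_of_mem_level (ha m) hp ((hac m).trans (hmono m.le_succ))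
      (hpa.le.trans (hac (m + 1)))]
  · exact eq_of_le_of_le_of_mem_level (ha n) hn (hac n) (hmono n.zero_le)

end Levels

/-! ### Rigid stabilizers -/

section Rist

variable {T : RootedTree.{u}} {G : Subgroup (T ≃o T)}

theorem mem_rist {g : G} {v : T} :
    g ∈ rist G v ↔ ∀ ξ : Boundary T, ξ ∉ cylinder v → (g : T ≃o T) • ξ = ξ := by
  rw [rist, rigidStabilizer, mem_fixingSubgroup_iff]
  rfl

/-- A ray through `v` cannot be moved out of the cylinder of `v`, since its image would be fixed. -/
theorem apply_eq_self_of_mem_rist (hT : ∀ v : T, ∃ w, v ⋖ w) {g : G} {v : T}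
    (hg : g ∈ rist G v) : (g : T ≃o T) v = v := by
  obtain ⟨ξ, hξ⟩ := nonempty_cylinder hT v
  obtain ⟨n, hn⟩ := exists_mem_level v
  have hmem : (g : T ≃o T) • ξ ∈ cylinder v := by
    by_contra h
    have h' := smul_left_cancel _ (mem_rist.1 hg _ h)
    rw [h'] at h
    exact h hξ
  rw [mem_cylinder_iff hn] at hmem hξ
  rw [smul_boundary_apply, hξ] at hmem
  exact hmem

/-- On a tree without leaves, the rigid stabilizer of `v` consists of the elements that fix all
vertices outside the subtree of `v`. -/
theorem mem_rist_iff (hT : ∀ v : T, ∃ w, v ⋖ w) {g : G} {v : T} :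
    g ∈ rist G v ↔ ∀ u, ¬ v ≤ u → (g : T ≃o T) u = u := by
  constructor
  · intro hg u hu
    by_cases huv : u ≤ v
    · exact apply_eq_of_le _ huv (apply_eq_self_of_mem_rist hT hg)
    · obtain ⟨ξ, n, hn⟩ := nonempty_cylinder hT u
      have hξ : ξ ∉ cylinder v := by
        rintro ⟨m, hm⟩
        rcases le_total n m with h | h
        · exact huv (hn ▸ hm ▸ ξ.monotone_vertex h)
        · exact hu (hn ▸ hm ▸ ξ.monotone_vertex h)
      have := congrArg (fun η => η.vertex n) (mem_rist.1 hg ξ hξ)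
      simpa [smul_boundary_apply, hn] using this
  · intro h
    refine mem_rist.2 fun ξ hξ => Boundary.ext (funext fun n => ?_)
    exact h _ fun hv => hξ (mem_cylinder_iff_le.2 ⟨n, hv⟩)

theorem rist_anti {v w : T} (h : v ≤ w) : rist G w ≤ rist G v := fun _ hg =>
  mem_rist.2 fun ξ hξ => mem_rist.1 hg ξ fun h' => hξ (cylinder_anti h h')

theorem conj_mem_rist (c : G) {g : G} {v : T} (hg : g ∈ rist G v) :
    c * g * c⁻¹ ∈ rist G ((c : T ≃o T) v) := by
  refine mem_rist.2 fun ξ hξ => ?_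
  have h : ((c : T ≃o T)⁻¹) • ξ ∉ cylinder v := by
    rwa [← smul_mem_cylinder_iff (c : T ≃o T), smul_inv_smul]
  have := mem_rist.1 hg _ h
  simp only [Subgroup.coe_mul, Subgroup.coe_inv, mul_smul, this, smul_inv_smul]

theorem conj_mem_rist_of_apply_eq {c g : G} {v : T} (hc : (c : T ≃o T) v = v)
    (hg : g ∈ rist G v) : c * g * c⁻¹ ∈ rist G v := by
  simpa only [hc] using conj_mem_rist c hg

/-- The rigid stabilizer of `v` fixes all vertices below a translate of `v` different from `v`. -/
theorem apply_eq_of_mem_rist (hT : ∀ v : T, ∃ w, v ⋖ w) {g c : G} {v z : T}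
    (hg : g ∈ rist G v) (hc : (c : T ≃o T) v ≠ v) (hz : (c : T ≃o T) v ≤ z) :
    (g : T ≃o T) z = z :=
  (mem_rist_iff hT).1 hg z fun h => hc (apply_eq_of_apply_le _ h hz)

theorem commute_of_mem_rist (hT : ∀ v : T, ∃ w, v ⋖ w) {n : ℕ} {v w : T} (hv : v ∈ level T n)
    (hw : w ∈ level T n) (hvw : v ≠ w) {a b : G} (ha : a ∈ rist G v) (hb : b ∈ rist G w) :
    Commute a b := by
  have key : ∀ {v w : T}, v ∈ level T n → w ∈ level T n → v ≠ w → ∀ {a b : G}, a ∈ rist G v →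
      b ∈ rist G w → ∀ z, v ≤ z → (a : T ≃o T) ((b : T ≃o T) z) = (b : T ≃o T) ((a : T ≃o T) z) := by
    intro v w hv hw hvw a b ha hb z hz
    have hva : v ≤ (a : T ≃o T) z := by
      simpa only [apply_eq_self_of_mem_rist hT ha] using (a : T ≃o T).monotone hz
    rw [(mem_rist_iff hT).1 hb z fun h => hvw (eq_of_le_of_le_of_mem_level hv hw hz h),
      (mem_rist_iff hT).1 hb _ fun h => hvw (eq_of_le_of_le_of_mem_level hv hw hva h)]
  refine Subtype.ext (OrderIso.ext (funext fun z => ?_))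
  change (a : T ≃o T) ((b : T ≃o T) z) = (b : T ≃o T) ((a : T ≃o T) z)
  by_cases h1 : v ≤ z
  · exact key hv hw hvw ha hb z h1
  by_cases h2 : w ≤ z
  · exact (key hw hv hvw.symm hb ha z h2).symm
  · rw [(mem_rist_iff hT).1 hb z h2, (mem_rist_iff hT).1 ha z h1, (mem_rist_iff hT).1 hb z h2]

theorem commute_conj_of_mem_rist (hT : ∀ v : T, ∃ w, v ⋖ w) {c a b : G} {v : T}
    (hc : (c : T ≃o T) v ≠ v) (ha : a ∈ rist G v) (hb : b ∈ rist G ((c : T ≃o T) v)) :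
    Commute a b := by
  obtain ⟨n, hn⟩ := exists_mem_level v
  exact commute_of_mem_rist hT hn (apply_mem_level _ hn) hc.symm ha hb

theorem rist_ne_bot (hT : ∀ v : T, ∃ w, v ⋖ w) (hG : MicroSupported G (Boundary T)) (v : T) :
    rist G v ≠ ⊥ :=
  hG _ (isOpen_cylinder v) (nonempty_cylinder hT v)

theorem exists_apply_ne (hT : ∀ v : T, ∃ w, v ⋖ w) {g : G} {v : T} (hg : g ∈ rist G v)
    (h1 : g ≠ 1) : ∃ z, v ≤ z ∧ (g : T ≃o T) z ≠ z := by
  by_contra! h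
  refine h1 (Subtype.ext (OrderIso.ext (funext fun z => ?_)))
  by_cases hz : v ≤ z
  · exact h z hz
  · exact (mem_rist_iff hT).1 hg z hz

/-- Rigid stabilizers of a micro-supported action have elements with arbitrarily long orbits of
vertices: if `g` returns to a vertex `z` after `k` steps, then multiplying `g` by a suitable element
of the rigid stabilizer of `z` makes the return non-trivial below `z`. -/
theorem exists_pow_apply_ne (hT : ∀ v : T, ∃ w, v ⋖ w) (hG : ∀ v : T, rist G v ≠ ⊥) (v : T)
    (k : ℕ) : ∃ g ∈ rist G v, ∃ z, v ≤ z ∧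
      ∀ i, 0 < i → i ≤ k → ((g ^ i : G) : T ≃o T) z ≠ z := by
  induction k with
  | zero => exact ⟨1, one_mem _, v, le_rfl, fun i h0 hi => by omega⟩
  | succ k ih =>
    obtain ⟨g, hg, z, hvz, hz⟩ := ih
    by_cases hk : ((g ^ (k + 1) : G) : T ≃o T) z = z
    swap
    · refine ⟨g, hg, z, hvz, fun i h0 hi => ?_⟩
      rcases Nat.le_succ_iff.1 hi with h | rfl
      exacts [hz i h0 h, hk]
    -- On the subtree of `z`, the power `(g * b) ^ i` acts as `g ^ i * b`.
    have hpow : ∀ b ∈ rist G z, ∀ y, z ≤ y → ∀ i ≤ k,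
        (((g * b) ^ (i + 1) : G) : T ≃o T) y = ((g ^ (i + 1) : G) : T ≃o T) ((b : T ≃o T) y) := by
      intro b hb y hy i
      induction i with
      | zero => intro _; simp
      | succ i ih =>
        intro hi
        have hzb : z ≤ (b : T ≃o T) y := by
          simpa only [apply_eq_self_of_mem_rist hT hb] using (b : T ≃o T).monotone hy
        rw [pow_succ', pow_succ' g (i + 1)]
        change (g : T ≃o T) ((b : T ≃o T) ((((g * b) ^ (i + 1) : G) : T ≃o T) y)) =
          (g : T ≃o T) (((g ^ (i + 1) : G) : T ≃o T) ((b : T ≃o T) y))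
        rw [ih (by omega), apply_eq_of_mem_rist hT hb (hz (i + 1) (by omega) hi)
          (((g ^ (i + 1) : G) : T ≃o T).monotone hzb)]
    obtain ⟨b, hb, y, hzy, hy⟩ : ∃ b ∈ rist G z, ∃ y, z ≤ y ∧
        ((g ^ (k + 1) : G) : T ≃o T) ((b : T ≃o T) y) ≠ y := by
      by_contra! h
      obtain ⟨⟨b, hb⟩, hb1⟩ := Subgroup.ne_bot_iff_exists_ne_one.1 (hG z)
      obtain ⟨y, hzy, hy⟩ := exists_apply_ne hT hb fun h => hb1 (Subtype.ext h)
      have h1 := h 1 (one_mem _) y hzy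
      have h2 := h _ hb y hzy
      exact hy (((g ^ (k + 1) : G) : T ≃o T).injective (h2.trans h1.symm))
    refine ⟨g * b, mul_mem hg (rist_anti hvz hb), y, hvz.trans hzy, fun i h0 hi => ?_⟩
    obtain ⟨j, rfl⟩ : ∃ j, i = j + 1 := ⟨i - 1, by omega⟩
    rw [hpow b hb y hzy j (by omega)]
    rcases Nat.le_succ_iff.1 hi with h | h
    · intro heq
      have hzb : z ≤ (b : T ≃o T) y := by
        simpa only [apply_eq_self_of_mem_rist hT hb] using (b : T ≃o T).monotone hzy
      refine hz (j + 1) h0 h (apply_eq_of_apply_le _ hzy ?_)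
      simpa only [heq] using ((g ^ (j + 1) : G) : T ≃o T).monotone hzb
    · rwa [show j + 1 = k + 1 from h]

/-! ### The commutator lemma -/

open scoped commutatorElement

/-- If `H` contains the conjugates of `p` by two powers of `g`, and `p` moves the support of `g` off
itself, then `H` contains a power of `g` up to a factor supported on the displaced copy. -/
theorem exists_pow_mul_mem (hT : ∀ v : T, ∃ w, v ⋖ w) {H : Subgroup G} {p g : G} {w : T}
    (hp : (p : T ≃o T) w ≠ w) (hg : g ∈ rist G w) {a i n : ℕ} (hn : i ∣ n)
    (h1 : g ^ a * p * (g ^ a)⁻¹ ∈ H) (h2 : g ^ (a + i) * p * (g ^ (a + i))⁻¹ ∈ H) :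
    ∃ e ∈ rist G ((p : T ≃o T) w), g ^ n * e ∈ H := by
  have he : p * (g ^ i)⁻¹ * p⁻¹ ∈ rist G ((p : T ≃o T) w) :=
    conj_mem_rist p (inv_mem (pow_mem hg i))
  have hmem : g ^ i * (p * (g ^ i)⁻¹ * p⁻¹) ∈ H := by
    have h := mul_mem h2 (inv_mem h1)
    have hcomm := commute_conj_of_mem_rist hT hp (pow_mem hg a) he
    have : g ^ (a + i) * p * (g ^ (a + i))⁻¹ * (g ^ a * p * (g ^ a)⁻¹)⁻¹ =
        g ^ i * (g ^ a * (p * (g ^ i)⁻¹ * p⁻¹) * (g ^ a)⁻¹) := by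
      rw [pow_add]
      have := (Commute.refl g).pow_pow a i
      rw [this.eq]
      group
    rwa [this, hcomm.eq, mul_inv_cancel_right] at h
  obtain ⟨k, rfl⟩ := hn
  refine ⟨(p * (g ^ i)⁻¹ * p⁻¹) ^ k, pow_mem he k, ?_⟩
  rw [pow_mul, ← (commute_conj_of_mem_rist hT hp (pow_mem hg i) he).mul_pow]
  exact pow_mem hmem k

open scoped Nat in
/-- Suppose that `H` contains, for each `γ` in the rigid stabilizer of `w`, the `γ`-conjugates of
one of finitely many pairs of elements, each of which moves `w` to two further vertices.  Then `H`
contains the commutators of suitable powers. -/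
theorem commutator_pow_mem (hT : ∀ v : T, ∃ w, v ⋖ w) {H : Subgroup G} {w : T} {ι : Type*}
    [Fintype ι] {p q : ι → G} (hp : ∀ s, (p s : T ≃o T) w ≠ w) (hq : ∀ s, (q s : T ≃o T) w ≠ w)
    (hpq : ∀ s, (p s : T ≃o T) w ≠ (q s : T ≃o T) w)
    (hH : ∀ γ ∈ rist G w, ∃ s, γ * p s * γ⁻¹ ∈ H ∧ γ * q s * γ⁻¹ ∈ H)
    {g k : G} (hg : g ∈ rist G w) (hk : k ∈ rist G w) :
    ⁅g ^ (Fintype.card ι)!, k ^ (Fintype.card ι)!⁆ ∈ H := by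
  have key : ∀ g ∈ rist G w, ∃ s,
      (∃ e ∈ rist G ((p s : T ≃o T) w), g ^ (Fintype.card ι)! * e ∈ H) ∧
      ∃ e ∈ rist G ((q s : T ≃o T) w), g ^ (Fintype.card ι)! * e ∈ H := by
    intro g hg
    choose s hs using fun a : Fin (Fintype.card ι + 1) => hH (g ^ (a : ℕ)) (pow_mem hg a)
    obtain ⟨a, b, hab, heq⟩ : ∃ a b, a < b ∧ s a = s b := by
      obtain ⟨a, b, hab, heq⟩ := Fintype.exists_ne_map_eq_of_card_lt s (by simp)
      rcases lt_or_gt_of_ne hab with h | h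
      exacts [⟨a, b, h, heq⟩, ⟨b, a, h, heq.symm⟩]
    have hab' : (a : ℕ) < b := hab
    have hdvd : (b - a : ℕ) ∣ (Fintype.card ι)! :=
      Nat.dvd_factorial (by omega) (by omega)
    have hb : (b : ℕ) = a + (b - a) := by omega
    have hsb := hs b
    rw [← heq, hb] at hsb
    exact ⟨s a, exists_pow_mul_mem hT (hp _) hg hdvd (hs a).1 hsb.1,
      exists_pow_mul_mem hT (hq _) hg hdvd (hs a).2 hsb.2⟩
  -- Two error terms supported on different vertices disappear from the commutator.
  have comm : ∀ {a b : G}, (a : T ≃o T) w ≠ w → (b : T ≃o T) w ≠ w →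
      (a : T ≃o T) w ≠ (b : T ≃o T) w → ∀ {g k : G}, g ∈ rist G w → k ∈ rist G w →
      (∃ e ∈ rist G ((a : T ≃o T) w), g * e ∈ H) →
      (∃ e ∈ rist G ((b : T ≃o T) w), k * e ∈ H) → ⁅g, k⁆ ∈ H := by
    rintro a b ha hb hab g k hg hk ⟨e, he, hge⟩ ⟨f, hf, hkf⟩
    obtain ⟨n, hn⟩ := exists_mem_level w
    have h1 := commute_conj_of_mem_rist hT ha hk he
    have h2 := commute_conj_of_mem_rist hT hb hg hf
    have h3 := commute_of_mem_rist hT (apply_mem_level _ hn) (apply_mem_level _ hn) hab he hf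
    have h4 := commute_conj_of_mem_rist hT ha hg he
    have h5 := commute_conj_of_mem_rist hT hb hk hf
    have : ⁅g * e, k * f⁆ = ⁅g, k⁆ := by
      have e1 : Commute e (k * f) := h1.symm.mul_right h3
      have e2 : Commute f (g : G) := h2.symm
      simp only [commutatorElement_def, mul_inv_rev]
      calc g * e * (k * f) * (e⁻¹ * g⁻¹) * (f⁻¹ * k⁻¹)
          = g * (e * (k * f)) * e⁻¹ * g⁻¹ * f⁻¹ * k⁻¹ := by group
        _ = g * k * (f * g⁻¹) * f⁻¹ * k⁻¹ := by rw [e1.eq]; group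
        _ = g * k * g⁻¹ * k⁻¹ := by rw [e2.inv_right.eq]; group
    rw [← this, commutatorElement_def]
    exact mul_mem (mul_mem (mul_mem hge hkf) (inv_mem hge)) (inv_mem hkf)
  obtain ⟨s, hs1, hs2⟩ := key g hg
  obtain ⟨t, ht1, ht2⟩ := key k hk
  by_cases hst : (p s : T ≃o T) w = (p t : T ≃o T) w
  · exact comm (hp s) (hq t) (hst ▸ hpq t) (pow_mem hg _) (pow_mem hk _) hs1 ht2
  · exact comm (hp s) (hp t) hst (pow_mem hg _) (pow_mem hk _) hs1 ht1

/-- A subgroup confined by finitely many elements that move `v`, where only conjugation by the rigid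
stabilizer of `v` is taken into account, contains commutators of powers of a rigid stabilizer. -/
theorem exists_commutator_pow_mem_of_confined (hT : ∀ v : T, ∃ w, v ⋖ w)
    (hG : ∀ v : T, rist G v ≠ ⊥) (v : T) (P : Finset G) (hP : ∀ p ∈ P, (p : T ≃o T) v ≠ v) :
    ∃ w, v ≤ w ∧ ∃ n, 0 < n ∧ ∀ H : Subgroup G, (∀ γ ∈ rist G v, ∃ p ∈ P, γ * p * γ⁻¹ ∈ H) →
      ∀ g ∈ rist G w, ∀ k ∈ rist G w, ⁅g ^ n, k ^ n⁆ ∈ H := by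
  obtain ⟨h, hh, w, hvw, hw⟩ := exists_pow_apply_ne hT hG v P.card
  let q : Fin (P.card + 1) → G := fun j => h ^ (j : ℕ)
  have hqmem : ∀ j, q j ∈ rist G v := fun j => pow_mem hh _
  have hqle : ∀ j, v ≤ (((q j)⁻¹ : G) : T ≃o T) w := fun j => by
    simpa only [apply_eq_self_of_mem_rist hT (inv_mem (hqmem j))] using
      (((q j)⁻¹ : G) : T ≃o T).monotone hvw
  have hqinj : ∀ i j, i < j → (((q i)⁻¹ : G) : T ≃o T) w ≠ (((q j)⁻¹ : G) : T ≃o T) w := by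
    intro i j hij heq
    have hij' : (i : ℕ) < j := hij
    refine hw (j - i) (by omega) (by omega) ?_
    have hqj : h ^ ((j : ℕ) - i) = q j * (q i)⁻¹ := pow_sub h hij'.le
    rw [hqj]
    change (q j : T ≃o T) ((((q i)⁻¹ : G) : T ≃o T) w) = w
    rw [heq]
    exact (q j : T ≃o T).apply_symm_apply w
  -- A colour records, for each `q j`, which element of `P` is available after conjugation; two of
  -- the `q j` get the same element, and their conjugates of it displace `w` differently.
  have hpair : ∀ c : Fin (P.card + 1) → P, ∃ i j, i < j ∧ c i = c j := by
    intro c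
    obtain ⟨i, j, hij, heq⟩ := Fintype.exists_ne_map_eq_of_card_lt c (by simp)
    rcases lt_or_gt_of_ne hij with h | h
    exacts [⟨i, j, h, heq⟩, ⟨j, i, h, heq.symm⟩]
  choose i j hij hcij using hpair
  have hnle : ∀ (p : P) (l), ¬ v ≤ ((p : G) : T ≃o T) ((((q l)⁻¹ : G) : T ≃o T) w) :=
    fun p l hle => hP p p.2 (apply_eq_of_apply_le _ hle (((p : G) : T ≃o T).monotone (hqle l)))
  have hconj : ∀ (p : P) (l), ((q l * p * (q l)⁻¹ : G) : T ≃o T) w =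
      ((p : G) : T ≃o T) ((((q l)⁻¹ : G) : T ≃o T) w) :=
    fun p l => (mem_rist_iff hT).1 (hqmem l) _ (hnle p l)
  have hne : ∀ (p : P) (l), ((q l * p * (q l)⁻¹ : G) : T ≃o T) w ≠ w := by
    intro p l heq
    rw [hconj] at heq
    exact hnle p l (hvw.trans heq.ge)
  refine ⟨w, hvw, _, Nat.factorial_pos _, fun H hH g hg k hk => commutator_pow_mem hT
    (ι := Fin (P.card + 1) → P)
    (p := fun c => q (i c) * (c (i c) : G) * (q (i c))⁻¹)
    (q := fun c => q (j c) * (c (j c) : G) * (q (j c))⁻¹)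
    (fun c => hne _ _) (fun c => hne _ _) (fun c => ?_) (fun γ hγ => ?_) hg hk⟩
  · rw [hconj, hconj, hcij c]
    exact fun h => hqinj _ _ (hij c) (((c (j c) : G) : T ≃o T).injective h)
  · choose c hcP hc using fun l => hH (γ * q l) (mul_mem (rist_anti hvw hγ) (hqmem l))
    refine ⟨fun l => ⟨c l, hcP l⟩, ?_, ?_⟩
    · simpa [mul_assoc] using hc (i fun l => ⟨c l, hcP l⟩)
    · simpa [mul_assoc] using hc (j fun l => ⟨c l, hcP l⟩)

/-- The double commutator trick: a subgroup that contains the conjugates `c * a * c⁻¹` of an element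
moving `u`, for all `c` in the rigid stabilizer of `u`, contains the derived subgroup of this
rigid stabilizer. -/
theorem commutator_rist_le_of_apply_ne (hT : ∀ v : T, ∃ w, v ⋖ w) {H : Subgroup G} {a : G} {u : T}
    (ha : (a : T ≃o T) u ≠ u) (hH : ∀ c ∈ rist G u, c * a * c⁻¹ ∈ H) :
    ⁅rist G u, rist G u⁆ ≤ H := by
  refine Subgroup.commutator_le.2 fun x hx y hy => ?_
  have hε := conj_mem_rist a (inv_mem hx)
  have hy' := commute_conj_of_mem_rist hT ha hy hε
  have h1 : x * a * x⁻¹ * a⁻¹ ∈ H :=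
    mul_mem (hH x hx) (inv_mem (by simpa using hH 1 (one_mem _)))
  have h2 : y * (x * a * x⁻¹ * a⁻¹)⁻¹ * y⁻¹ ∈ H := by
    have := mul_mem (hH y hy) (inv_mem (hH (y * x) (mul_mem hy hx)))
    convert this using 1
    group
  have : ⁅x, y⁆ = x * a * x⁻¹ * a⁻¹ * (y * (x * a * x⁻¹ * a⁻¹)⁻¹ * y⁻¹) := by
    calc ⁅x, y⁆ = x * y * x⁻¹ * y⁻¹ := commutatorElement_def x y
      _ = x * ((a * x⁻¹ * a⁻¹) * y) * (a * x⁻¹ * a⁻¹)⁻¹ * x⁻¹ * y⁻¹ := by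
        rw [← hy'.eq]; group
      _ = _ := by group
  rw [this]
  exact mul_mem h1 h2

/-- Commutators of `n`-th powers in the rigid stabilizer of `w` suffice to generate the derived
subgroups of the rigid stabilizers of all sufficiently deep vertices below `w`. -/
theorem exists_level_commutator_rist_le (hT : ∀ v : T, ∃ w, v ⋖ w) (hG : ∀ v : T, rist G v ≠ ⊥)
    (hGt : LevelTransitive G) (w : T) {n : ℕ} (hn : 0 < n) :
    ∃ m, ∀ l, m ≤ l → ∀ u ∈ level T l, w ≤ u → ∀ H : Subgroup G,
      (∀ g ∈ rist G w, ∀ k ∈ rist G w, ⁅g ^ n, k ^ n⁆ ∈ H) → ⁅rist G u, rist G u⁆ ≤ H := by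
  obtain ⟨g, hg, k, hk, hne⟩ : ∃ g ∈ rist G w, ∃ k ∈ rist G w, ⁅g ^ n, k ^ n⁆ ≠ 1 := by
    obtain ⟨g, hg, z, hwz, hz⟩ := exists_pow_apply_ne hT hG w n
    obtain ⟨k, hk, y, hzy, hy⟩ := exists_pow_apply_ne hT hG z n
    refine ⟨g, hg, k, rist_anti hwz hk, fun h => hy n hn le_rfl ?_⟩
    have h1 := congrArg (fun a : G => (a : T ≃o T) y) (commutatorElement_eq_one_iff_mul_comm.1 h)
    change ((g ^ n : G) : T ≃o T) (((k ^ n : G) : T ≃o T) y) =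
      ((k ^ n : G) : T ≃o T) (((g ^ n : G) : T ≃o T) y) at h1
    rw [apply_eq_of_mem_rist hT (pow_mem hk n) (hz n hn le_rfl)
      (((g ^ n : G) : T ≃o T).monotone hzy)] at h1
    exact ((g ^ n : G) : T ≃o T).injective h1
  have hmem : ⁅g ^ n, k ^ n⁆ ∈ rist G w := by
    rw [commutatorElement_def]
    have hg' := pow_mem hg n
    have hk' := pow_mem hk n
    exact mul_mem (mul_mem (mul_mem hg' hk') (inv_mem hg')) (inv_mem hk')
  obtain ⟨u₀, hwu₀, hu₀⟩ := exists_apply_ne hT hmem hne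
  obtain ⟨m, hm⟩ := exists_mem_level u₀
  refine ⟨m, fun l hl u hu hwu H hH => ?_⟩
  -- Level-transitivity moves the commutator to one that moves the given vertex.
  obtain ⟨u₁, hu₁, hle⟩ := exists_ancestor hu hl
  obtain ⟨c, hcG, hc⟩ := hGt m u₀ hm u₁ hu₁
  have hcw : c w = w := apply_eq_of_apply_le c hwu (((c.monotone hwu₀).trans hc.le).trans hle)
  lift c to G using hcG
  have hconj : ∀ x : G, (x : T ≃o T) w = w → x * ⁅g ^ n, k ^ n⁆ * x⁻¹ ∈ H := by
    intro x hx
    have h : x * ⁅g ^ n, k ^ n⁆ * x⁻¹ = ⁅(x * g * x⁻¹) ^ n, (x * k * x⁻¹) ^ n⁆ := by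
      have := map_commutatorElement (MulAut.conj x) (g ^ n) (k ^ n)
      simpa only [map_pow, MulAut.conj_apply] using this
    rw [h]
    exact hH _ (conj_mem_rist_of_apply_eq hx hg) _ (conj_mem_rist_of_apply_eq hx hk)
  refine commutator_rist_le_of_apply_ne hT (a := c * ⁅g ^ n, k ^ n⁆ * c⁻¹) (fun h => hu₀ ?_)
    fun x hx => ?_
  · have h1 := apply_eq_of_le _ hle h
    rw [← hc] at h1
    change (c : T ≃o T) ((⁅g ^ n, k ^ n⁆ : G).1 ((c : T ≃o T).symm ((c : T ≃o T) u₀))) = _ at h1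
    rw [OrderIso.symm_apply_apply] at h1
    exact (c : T ≃o T).injective h1
  · have := hconj (x * c) ?_
    · simpa only [mul_assoc, mul_inv_rev] using this
    · change (x : T ≃o T) ((c : T ≃o T) w) = w
      rw [hcw]
      exact apply_eq_of_le _ hwu (apply_eq_self_of_mem_rist hT hx)

end Rist

/-! ### Equivariant semi-continuous families of vertices -/

section Dynamics

variable {T : RootedTree.{u}} {G : Subgroup (T ≃o T)} {X : Type v} [TopologicalSpace X]
  [MulAction G X] [MulAction.IsMinimal G X]

/-- An equivariant family of sets of vertices that is lower semi-continuous is locally constant: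
by minimality the number of its vertices on a given level does not depend on the point. -/
theorem isClosed_of_equivariant (hT : LocallyFinite T) {p : X → T → Prop}
    (hp : ∀ (g : G) (x : X) (v : T), p x v → p (g • x) ((g : T ≃o T) v))
    (ho : ∀ v, IsOpen {x | p x v}) (v : T) : IsClosed {x | p x v} := by
  obtain ⟨n, hn⟩ := exists_mem_level v
  let S : X → Set T := fun x => {u ∈ level T n | p x u}
  have hfin : ∀ x, (S x).Finite := fun x => (finite_level hT n).subset fun u hu => hu.1
  have hopen : ∀ x, IsOpen {y | S x ⊆ S y} := by
    intro x
    have : {y | S x ⊆ S y} = ⋂ u ∈ S x, {y | p y u} := by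
      ext y
      simp only [Set.mem_iInter]
      exact ⟨fun h u hu => (h hu).2, fun h u hu => ⟨hu.1, h u hu⟩⟩
    rw [this]
    exact (hfin x).isOpen_biInter fun u _ => ho u
  have hle : ∀ (g : G) x, (S x).ncard ≤ (S (g • x)).ncard := fun g x =>
    Set.ncard_le_ncard_of_injOn (g : T ≃o T)
      (fun u hu => ⟨apply_mem_level _ hu.1, hp g x u hu.2⟩)
      (g : T ≃o T).injective.injOn (hfin _)
  have hconst : ∀ x y, (S x).ncard ≤ (S y).ncard := by
    intro x y
    obtain ⟨g, hg⟩ := (hopen x).exists_smul_mem G y ⟨x, Set.Subset.refl (S x)⟩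
    refine (Set.ncard_le_ncard hg (hfin _)).trans ?_
    simpa only [inv_smul_smul] using hle g⁻¹ (g • y)
  refine ⟨isOpen_iff_forall_mem_open.2 fun x hx =>
    ⟨_, fun y hy hpy => hx ?_, hopen x, Set.Subset.refl (S x)⟩⟩
  have heq : S x = S y := Set.eq_of_subset_of_ncard_le hy (hconst y x) (hfin y)
  have : v ∈ S x := heq ▸ (⟨hn, hpy⟩ : v ∈ S y)
  exact this.2

end Dynamics

section Sub

variable {T : RootedTree.{u}} {G : Subgroup (T ≃o T)} {X : Type v} {Φ : X → Subgroup G}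

theorem ConjEquivariant.conj_mem [MulAction G X] (hΦG : ConjEquivariant Φ) (g : G) {h : G} {x : X}
    (hh : h ∈ Φ x) : g * h * g⁻¹ ∈ Φ (g • x) := by
  rw [hΦG]
  exact ⟨h, hh, rfl⟩

theorem fix_smul [MulAction G X] (hΦG : ConjEquivariant Φ) (g : G) (x : X) :
    fix (Φ (g • x)) = g • fix (Φ x) := by
  have key : ∀ (g : G) (x : X) (ξ : Boundary T), ξ ∈ fix (Φ x) →
      (g : T ≃o T) • ξ ∈ fix (Φ (g • x)) := by
    intro g x ξ hξ h hh
    rw [hΦG] at hh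
    obtain ⟨k, hk, rfl⟩ := hh
    have := hξ k hk
    change (g * k * g⁻¹) • (g • ξ) = g • ξ
    rw [mul_smul, inv_smul_smul, mul_smul, this]
  refine Closeds.ext (Set.Subset.antisymm (fun ξ hξ => ?_) ?_)
  · refine ⟨(g : T ≃o T)⁻¹ • ξ, ?_, smul_inv_smul _ _⟩
    have := key g⁻¹ (g • x) ξ hξ
    rwa [inv_smul_smul] at this
  · rintro _ ⟨ξ, hξ, rfl⟩
    exact key g x ξ hξ

/-- The subgroup `H` moves the vertex `v`. -/
def Moves (H : Subgroup G) (v : T) : Prop :=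
  ∃ h ∈ H, (h : T ≃o T) v ≠ v

theorem moves_smul [MulAction G X] (hΦG : ConjEquivariant Φ) (g : G) (x : X) (v : T)
    (h : Moves (Φ x) v) : Moves (Φ (g • x)) ((g : T ≃o T) v) := by
  obtain ⟨k, hk, hkv⟩ := h
  refine ⟨_, hΦG.conj_mem g hk, fun h => hkv ?_⟩
  change (g : T ≃o T) ((k : T ≃o T) ((g : T ≃o T).symm ((g : T ≃o T) v))) = _ at h
  rw [OrderIso.symm_apply_apply] at h
  exact (g : T ≃o T).injective h

theorem fix_inter_cylinder_smul [MulAction G X] (hΦG : ConjEquivariant Φ) (g : G) (x : X) (v : T)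
    (h : (fix (Φ x) : Set (Boundary T)) ∩ cylinder v = ∅) :
    (fix (Φ (g • x)) : Set (Boundary T)) ∩ cylinder ((g : T ≃o T) v) = ∅ := by
  rw [fix_smul hΦG]
  refine Set.eq_empty_iff_forall_notMem.2 ?_
  rintro _ ⟨⟨ξ, hξ, rfl⟩, hξv⟩
  exact (Set.eq_empty_iff_forall_notMem.1 h ξ) ⟨hξ, (smul_mem_cylinder_iff _ _ _).1 hξv⟩

theorem exists_moves_of_notMem_fix {H : Subgroup G} {ξ : Boundary T} (hξ : ξ ∉ fix H) :
    ∃ k, Moves H (ξ.vertex k) := by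
  by_contra! h
  refine hξ fun g hg => Boundary.ext (funext fun n => ?_)
  by_contra hne
  exact h n ⟨g, hg, hne⟩

theorem Moves.mono {H : Subgroup G} {v w : T} (h : Moves H v) (hvw : v ≤ w) : Moves H w := by
  obtain ⟨g, hg, hgv⟩ := h
  exact ⟨g, hg, fun hw => hgv (apply_eq_of_le _ hvw hw)⟩

theorem LowerSemicontinuousSub.isOpen_mem [TopologicalSpace X] (hΦ : LowerSemicontinuousSub Φ)
    (h : G) : IsOpen {x | h ∈ Φ x} := by
  simpa [Set.inter_singleton_nonempty] using hΦ {h}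

theorem LowerSemicontinuousSub.isOpen_moves [TopologicalSpace X] (hΦ : LowerSemicontinuousSub Φ)
    (v : T) : IsOpen {x | Moves (Φ x) v} :=
  hΦ {h | (h : T ≃o T) v ≠ v}

/-- Finitely many elements of `Φ x` suffice to move all points of a compact set without fixed points,
and these elements belong to `Φ y` for `y` near `x`. -/
theorem LowerSemicontinuousSub.isOpen_fix_inter_eq_empty [TopologicalSpace X]
    (hΦ : LowerSemicontinuousSub Φ) {K : Set (Boundary T)} (hK : IsCompact K) :
    IsOpen {x | (fix (Φ x) : Set (Boundary T)) ∩ K = ∅} := by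
  refine isOpen_iff_forall_mem_open.2 fun x hx => ?_
  obtain ⟨t, htx, ht, hKt⟩ := hK.elim_finite_subcover_image (b := (Φ x : Set G))
    (c := fun h => {ξ | (h : T ≃o T) • ξ ≠ ξ})
    (fun h _ => (isClosed_eq (continuous_const_smul (h : T ≃o T)) continuous_id).isOpen_compl) (by
      intro ξ hξ
      have hξx : ξ ∉ fix (Φ x) := fun h => Set.eq_empty_iff_forall_notMem.1 hx ξ ⟨h, hξ⟩
      by_contra hcon
      simp only [Set.mem_iUnion, not_exists] at hcon
      refine hξx fun h hh => ?_
      by_contra hne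
      exact hcon h hh hne)
  refine ⟨⋂ h ∈ t, {y | h ∈ Φ y}, fun y hy => ?_, ht.isOpen_biInter fun h _ => hΦ.isOpen_mem h, ?_⟩
  · simp only [Set.mem_iInter] at hy
    refine Set.eq_empty_iff_forall_notMem.2 fun ξ hξ => ?_
    obtain ⟨h, hht, hne⟩ := Set.mem_iUnion₂.1 (hKt hξ.2)
    exact hne (hξ.1 h (hy h hht))
  · simp only [Set.mem_iInter]
    exact fun h hh => htx hh

variable [TopologicalSpace X] [MulAction G X] [MulAction.IsMinimal G X]

theorem isClosed_fix_inter_cylinder_eq_empty (hT : LocallyFinite T)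
    (hΦ : LowerSemicontinuousSub Φ) (hΦG : ConjEquivariant Φ) (v : T) :
    IsClosed {x | (fix (Φ x) : Set (Boundary T)) ∩ cylinder v = ∅} :=
  isClosed_of_equivariant hT (p := fun x v => (fix (Φ x) : Set (Boundary T)) ∩ cylinder v = ∅)
    (fix_inter_cylinder_smul hΦG)
    (fun v => hΦ.isOpen_fix_inter_eq_empty (isCompact_cylinder hT v)) v

theorem continuous_fix (hT : LocallyFinite T)
    (hΦ : LowerSemicontinuousSub Φ) (hΦG : ConjEquivariant Φ) :
    Continuous fun x => fix (Φ x) := by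
  refine continuous_generateFrom_iff.2 ?_
  rintro _ (⟨K, hK, rfl⟩ | ⟨U, hU, rfl⟩)
  · exact hΦ.isOpen_fix_inter_eq_empty hK
  · refine isOpen_iff_forall_mem_open.2 ?_
    rintro x ⟨ξ, hξ, hξU⟩
    obtain ⟨n, hn⟩ := exists_cylinder_subset hU hξU
    refine ⟨_, fun y hy => ?_,
      (isClosed_fix_inter_cylinder_eq_empty hT hΦ hΦG (ξ.vertex n)).isOpen_compl, ?_⟩
    · obtain ⟨η, hη, hηv⟩ := Set.nonempty_iff_ne_empty.2 hy
      exact ⟨η, hη, hn hηv⟩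
    · exact Set.Nonempty.ne_empty ⟨ξ, hξ, n, rfl⟩

/-! ### Uniform containment of derived subgroups -/

variable [CompactSpace X]

/-- For all points `x` such that `Φ x` moves `v`, the subgroup `Φ x` contains the derived subgroups
of the rigid stabilizers below `v`, from a level on that does not depend on `x`.  These points form
a compact set that is invariant under the stabilizer of `v`, so that finitely many elements moving
`v` confine `Φ x`. -/
theorem exists_level_of_moves (hG : IsWeaklyBranch G) (hT : ∀ v : T, ∃ w, v ⋖ w)
    (hΦ : LowerSemicontinuousSub Φ) (hΦG : ConjEquivariant Φ) (v : T) :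
    ∃ m, ∀ l, m ≤ l → ∀ u ∈ level T l, v ≤ u → ∀ x, Moves (Φ x) v →
      ⁅rist G u, rist G u⁆ ≤ Φ x := by
  have hclosed : IsClosed {x | Moves (Φ x) v} :=
    isClosed_of_equivariant hG.locallyFinite (p := fun x v => Moves (Φ x) v)
      (moves_smul hΦG) hΦ.isOpen_moves v
  obtain ⟨t, htv, ht, hcov⟩ := hclosed.isCompact.elim_finite_subcover_image
    (b := {h : G | (h : T ≃o T) v ≠ v}) (c := fun h => {x | h ∈ Φ x})
    (fun h _ => hΦ.isOpen_mem h) (fun x ⟨h, hh, hhv⟩ => Set.mem_biUnion (x := h) hhv hh)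
  have hrist := rist_ne_bot (G := G) hT hG.microSupported
  obtain ⟨w, hvw, n, hn, hw⟩ := exists_commutator_pow_mem_of_confined hT hrist v ht.toFinset
    fun p hp => htv (ht.mem_toFinset.1 hp)
  obtain ⟨m, hm⟩ := exists_level_commutator_rist_le hT hrist hG.levelTransitive w hn
  obtain ⟨k, hk⟩ := exists_mem_level w
  obtain ⟨j, hj⟩ := exists_mem_level v
  refine ⟨max m k, fun l hl u hu hvu x hx => ?_⟩
  -- It suffices to treat vertices below `w`, by means of an element of the stabilizer of `v`.
  obtain ⟨u', hu', hle⟩ := exists_ancestor hu ((le_max_right _ _).trans hl)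
  have hvu' : v ≤ u' := le_of_le_of_mem_level hj hu' (level_le_of_le hj hk hvw) hvu hle
  obtain ⟨c, hcG, hc⟩ := hG.levelTransitive k u' hu' w hk
  have hcv : c v = v := apply_eq_of_apply_le c hvw ((c.monotone hvu').trans hc.le)
  lift c to G using hcG
  have hcx : Moves (Φ (c • x)) v := by
    simpa only [hcv] using moves_smul hΦG c x v hx
  have key := hm l ((le_max_left _ _).trans hl) _ (apply_mem_level (c : T ≃o T) hu)
    (hc.ge.trans ((c : T ≃o T).monotone hle)) (Φ (c • x)) (hw _ fun γ hγ => ?_)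
  · refine Subgroup.commutator_le.2 fun a ha b hb => ?_
    have h := key (Subgroup.commutator_mem_commutator (conj_mem_rist c ha) (conj_mem_rist c hb))
    have h' := hΦG.conj_mem c⁻¹ h
    rw [inv_smul_smul] at h'
    convert h' using 1
    simp only [commutatorElement_def]
    group
  · have hγx : Moves (Φ (γ⁻¹ • c • x)) v := by
      simpa only [apply_eq_self_of_mem_rist hT (inv_mem hγ)] using
        moves_smul hΦG γ⁻¹ (c • x) v hcx
    obtain ⟨p, hp, hpx⟩ := Set.mem_iUnion₂.1 (hcov hγx)
    refine ⟨p, ht.mem_toFinset.2 hp, ?_⟩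
    simpa only [smul_inv_smul] using hΦG.conj_mem γ hpx

/-- If the cylinder of `v` contains no fixed point of `Φ x`, then `Φ x` moves all vertices below `v`
on some level, which by compactness can be chosen independently of `x`. -/
theorem exists_level_of_fix_inter_cylinder_eq_empty (hG : IsWeaklyBranch G)
    (hT : ∀ v : T, ∃ w, v ⋖ w) (hΦ : LowerSemicontinuousSub Φ) (hΦG : ConjEquivariant Φ) (v : T) :
    ∃ m, ∀ l, m ≤ l → ∀ u ∈ level T l, v ≤ u → ∀ x,
      (fix (Φ x) : Set (Boundary T)) ∩ cylinder v = ∅ → ⁅rist G u, rist G u⁆ ≤ Φ x := by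
  let O : ℕ → Set X := fun k => {x | ∀ ξ ∈ cylinder v, Moves (Φ x) (ξ.vertex k)}
  have hO : ∀ k, IsOpen (O k) := by
    intro k
    have : O k = ⋂ u ∈ (fun ξ : Boundary T => ξ.vertex k) '' cylinder v, {x | Moves (Φ x) u} := by
      ext x
      simp [O]
    rw [this]
    refine Set.Finite.isOpen_biInter ?_ fun u _ => hΦ.isOpen_moves u
    refine (finite_level hG.locallyFinite k).subset ?_
    rintro _ ⟨ξ, -, rfl⟩
    exact ξ.vertex_mem_level k
  have hOmono : Monotone O := fun k l hkl x hx ξ hξ => (hx ξ hξ).mono (ξ.monotone_vertex hkl)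
  obtain ⟨k, hk⟩ := (isClosed_fix_inter_cylinder_eq_empty hG.locallyFinite hΦ hΦG
      v).isCompact.elim_directed_cover O hO (fun x hx => by
    obtain ⟨k, hk⟩ := (isCompact_cylinder hG.locallyFinite v).elim_directed_cover
      (fun k => {ξ : Boundary T | Moves (Φ x) (ξ.vertex k)})
      (fun k => by
        let : TopologicalSpace T := ⊥
        have : DiscreteTopology T := ⟨rfl⟩
        exact (isOpen_discrete {u : T | Moves (Φ x) u}).preimage (continuous_coord k))
      (fun ξ hξ => Set.mem_iUnion.2 (exists_moves_of_notMem_fix fun h =>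
        Set.eq_empty_iff_forall_notMem.1 hx ξ ⟨h, hξ⟩))
      (Monotone.directed_le fun k l hkl ξ hξ => Moves.mono hξ (ξ.monotone_vertex hkl))
    exact Set.mem_iUnion.2 ⟨k, hk⟩) hOmono.directed_le
  choose m hm using exists_level_of_moves hG hT hΦ hΦG
  refine ⟨max k ((finite_level hG.locallyFinite k).toFinset.sup m), fun l hl u hu hvu x hx => ?_⟩
  obtain ⟨ξ, hξ⟩ := nonempty_cylinder hT u
  have hξu := (mem_cylinder_iff hu).1 hξ
  refine hm (ξ.vertex k) l ?_ u hu ?_ x (hk hx ξ (cylinder_anti hvu hξ))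
  · refine le_trans (Finset.le_sup (f := m) ?_) ((le_max_right _ _).trans hl)
    exact (Set.Finite.mem_toFinset _).2 (ξ.vertex_mem_level k)
  · exact hξu ▸ ξ.monotone_vertex ((le_max_left _ _).trans hl)

theorem exists_level_function (hG : IsWeaklyBranch G)
    (hT : ∀ v : T, ∃ w, v ⋖ w) (hΦ : LowerSemicontinuousSub Φ) (hΦG : ConjEquivariant Φ) :
    ∃ f : ℕ → ℕ, (∀ n, n ≤ f n) ∧ ∀ n, ∀ v ∈ level T n, ∀ u ∈ level T (f n), v ≤ u → ∀ x,
      (fix (Φ x) : Set (Boundary T)) ∩ cylinder v = ∅ → ⁅rist G u, rist G u⁆ ≤ Φ x := by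
  choose m hm using exists_level_of_fix_inter_cylinder_eq_empty hG hT hΦ hΦG
  refine ⟨fun n => max n ((finite_level hG.locallyFinite n).toFinset.sup m),
    fun n => le_max_left _ _, fun n v hv u hu hvu x hx => hm v _ ?_ u hu hvu x hx⟩
  exact (Finset.le_sup (f := m) ((Set.Finite.mem_toFinset _).2 hv)).trans (le_max_right _ _)

end Sub

/-! ### Refining the canonical decomposition of the complement of a closed set -/

section Section

variable {T : RootedTree.{u}}

/-- The vertex `v` is minimal among those whose cylinder is disjoint from `C`.  The cylinders of
these vertices partition the complement of `C`. -/
def IsMinimalAvoiding (C : Closeds (Boundary T)) (v : T) : Prop :=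
  (C : Set (Boundary T)) ∩ cylinder v = ∅ ∧
    ∀ w, w < v → ((C : Set (Boundary T)) ∩ cylinder w).Nonempty

theorem IsMinimalAvoiding.eq_of_le {C : Closeds (Boundary T)} {v w z : T}
    (hv : IsMinimalAvoiding C v) (hw : IsMinimalAvoiding C w) (hvz : v ≤ z) (hwz : w ≤ z) :
    v = w := by
  have key : ∀ {v w : T}, IsMinimalAvoiding C v → IsMinimalAvoiding C w → v ≤ w → v = w := by
    intro v w hv hw h
    by_contra hne
    exact (hw.2 v (lt_of_le_of_ne h hne)).ne_empty hv.1
  rcases le_total_of_le hvz hwz with h | h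
  exacts [key hv hw h, (key hw hv h).symm]

/-- Each vertex that is minimal with a cylinder disjoint from `C`, on level `n` say, is replaced by
its descendants on level `f n`. -/
def refinedComplement (f : ℕ → ℕ) (C : Closeds (Boundary T)) : Antichains T where
  verts := {u | ∃ v, v ≤ u ∧ (∃ n, v ∈ level T n ∧ u ∈ level T (f n)) ∧ IsMinimalAvoiding C v}
  independent := by
    rintro u ⟨v, hvu, ⟨n, hn, hu⟩, hv⟩ u' ⟨v', hvu', ⟨n', hn', hu'⟩, hv'⟩ hne
    rw [Set.disjoint_left]
    intro z hz hz'
    obtain rfl := hv.eq_of_le hv' (hvu.trans hz) (hvu'.trans hz')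
    obtain rfl := level_eq hn hn'
    exact hne (eq_of_le_of_le_of_mem_level hu hu' hz hz')

theorem piPerp_refinedComplement {f : ℕ → ℕ} (hf : ∀ n, n ≤ f n) (C : Closeds (Boundary T)) :
    piPerp (refinedComplement f C) = C := by
  classical
  refine Closeds.ext (compl_eq_comm.1 (Set.ext fun ξ => ?_))
  simp only [Set.mem_compl_iff, Set.mem_iUnion, exists_prop]
  constructor
  · intro hξ
    have hex : ∃ n, (C : Set (Boundary T)) ∩ cylinder (ξ.vertex n) = ∅ := by
      obtain ⟨n, hn⟩ := exists_cylinder_subset C.isClosed.isOpen_compl hξ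
      exact ⟨n, Set.disjoint_iff_inter_eq_empty.1 (Set.subset_compl_iff_disjoint_left.1 hn)⟩
    refine ⟨ξ.vertex (f (Nat.find hex)), ⟨ξ.vertex (Nat.find hex), ξ.monotone_vertex (hf _),
      ⟨_, ξ.vertex_mem_level _, ξ.vertex_mem_level _⟩, Nat.find_spec hex, fun w hw => ?_⟩, _, rfl⟩
    obtain ⟨m, hm⟩ := exists_mem_level w
    obtain rfl := ξ.vertex_eq_of_le hm hw.le
    refine Set.nonempty_iff_ne_empty.2 (Nat.find_min hex ?_)
    by_contra hle
    exact (ξ.monotone_vertex (not_lt.1 hle)).not_gt hw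
  · rintro ⟨u, ⟨v, hvu, -, hv⟩, hξ⟩ hC
    exact Set.eq_empty_iff_forall_notMem.1 hv.1 ξ ⟨hC, cylinder_anti hvu hξ⟩

theorem smul_inter_cylinder (g : T ≃o T) (C : Closeds (Boundary T)) (v : T) :
    ((g • C : Closeds (Boundary T)) : Set (Boundary T)) ∩ cylinder (g v) =
      (fun ξ => g • ξ) '' ((C : Set (Boundary T)) ∩ cylinder v) := by
  ext ξ
  constructor
  · rintro ⟨⟨η, hη, rfl⟩, hv⟩
    exact ⟨η, ⟨hη, (smul_mem_cylinder_iff _ _ _).1 hv⟩, rfl⟩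
  · rintro ⟨η, ⟨hη, hv⟩, rfl⟩
    exact ⟨⟨η, hη, rfl⟩, (smul_mem_cylinder_iff _ _ _).2 hv⟩

theorem IsMinimalAvoiding.smul (g : T ≃o T) {C : Closeds (Boundary T)} {v : T}
    (h : IsMinimalAvoiding C v) : IsMinimalAvoiding (g • C) (g v) := by
  refine ⟨by rw [smul_inter_cylinder, h.1, Set.image_empty], fun w hw => ?_⟩
  obtain ⟨w, rfl⟩ := g.surjective w
  rw [smul_inter_cylinder]
  exact (h.2 w (g.lt_iff_lt.1 hw)).image _

theorem refinedComplement_smul (f : ℕ → ℕ) (g : T ≃o T) (C : Closeds (Boundary T)) :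
    refinedComplement f (g • C) = g • refinedComplement f C := by
  have key : ∀ (g : T ≃o T) (C : Closeds (Boundary T)) (u : T),
      u ∈ (refinedComplement f C).verts → g u ∈ (refinedComplement f (g • C)).verts := by
    rintro g C u ⟨v, hvu, ⟨n, hn, hu⟩, hv⟩
    exact ⟨g v, g.monotone hvu, ⟨n, apply_mem_level g hn, apply_mem_level g hu⟩, hv.smul g⟩
  refine Antichains.ext (Set.Subset.antisymm (fun u hu => ?_) ?_)
  · have h := key g⁻¹ (g • C) u hu
    rw [inv_smul_smul] at h
    exact ⟨g⁻¹ u, h, g.apply_symm_apply u⟩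
  · rintro _ ⟨u, hu, rfl⟩
    exact key g C u hu

theorem isClopen_inter_cylinder_eq_empty (hT : LocallyFinite T) (v : T) :
    IsClopen {C : Closeds (Boundary T) | (C : Set (Boundary T)) ∩ cylinder v = ∅} := by
  constructor
  · rw [← isOpen_compl_iff]
    refine isOpen_generateFrom_of_mem (Or.inr ⟨cylinder v, isOpen_cylinder v, ?_⟩)
    ext C
    exact Set.nonempty_iff_ne_empty.symm
  · exact isOpen_generateFrom_of_mem (Or.inl ⟨cylinder v, isCompact_cylinder hT v, rfl⟩)

theorem finite_Iic (v : T) : (Set.Iic v).Finite := by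
  obtain ⟨n, hn⟩ := exists_mem_level v
  induction n generalizing v with
  | zero =>
    obtain rfl : v = ⊥ := hn
    simp
  | succ n ih =>
    obtain ⟨p, hp, hpv⟩ := hn
    refine ((ih p hp).insert v).subset fun u hu => ?_
    rcases (show u ≤ v from hu).eq_or_lt with rfl | h
    exacts [Set.mem_insert _ _, Set.mem_insert_of_mem _ (le_of_lt_of_covBy h hpv)]

theorem isClopen_isMinimalAvoiding (hT : LocallyFinite T) (v : T) :
    IsClopen {C : Closeds (Boundary T) | IsMinimalAvoiding C v} := by
  have : {C : Closeds (Boundary T) | IsMinimalAvoiding C v} =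
      {C : Closeds (Boundary T) | (C : Set (Boundary T)) ∩ cylinder v = ∅} ∩
        ⋂ w ∈ Set.Iio v, {C : Closeds (Boundary T) | (C : Set (Boundary T)) ∩ cylinder w = ∅}ᶜ := by
    ext C
    simp [IsMinimalAvoiding, Set.nonempty_iff_ne_empty]
  rw [this]
  exact (isClopen_inter_cylinder_eq_empty hT v).inter
    (((finite_Iic v).subset Set.Iio_subset_Iic_self).isClopen_biInter
      fun w _ => (isClopen_inter_cylinder_eq_empty hT w).compl)

/-- A given vertex has finitely many ancestors, so its membership is a clopen condition. -/
theorem continuous_refinedComplement (hT : LocallyFinite T) (f : ℕ → ℕ) :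
    Continuous (refinedComplement f : Closeds (Boundary T) → Antichains T) := by
  let : TopologicalSpace Prop := ⊥
  have : DiscreteTopology Prop := ⟨rfl⟩
  refine continuous_induced_rng.2 (continuous_pi fun u => ?_)
  have hclopen : IsClopen {C : Closeds (Boundary T) | u ∈ (refinedComplement f C).verts} := by
    have : {C : Closeds (Boundary T) | u ∈ (refinedComplement f C).verts} =
        ⋃ v ∈ {v | v ≤ u ∧ ∃ n, v ∈ level T n ∧ u ∈ level T (f n)},
          {C : Closeds (Boundary T) | IsMinimalAvoiding C v} := by
      ext C
      simp only [refinedComplement, Set.mem_iUnion]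
      exact ⟨fun ⟨v, h1, h2, h3⟩ => ⟨v, ⟨h1, h2⟩, h3⟩, fun ⟨v, ⟨h1, h2⟩, h3⟩ => ⟨v, h1, h2, h3⟩⟩
    rw [this]
    exact ((finite_Iic u).subset fun v hv => hv.1).isClopen_biUnion
      fun v _ => isClopen_isMinimalAvoiding hT v
  refine IsLocallyConstant.continuous (IsLocallyConstant.iff_exists_open _ |>.2 fun C => ?_)
  by_cases hC : u ∈ (refinedComplement f C).verts
  · exact ⟨_, hclopen.isOpen, hC, fun D hD => by simpa [hC] using hD⟩
  · exact ⟨_, hclopen.compl.isOpen, hC, fun D hD => by simpa [hC] using hD⟩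

end Section
end TreeAction

theorem mainTheorem3 (T : RootedTree.{u}) (G : Subgroup (T ≃o T))
    (hG : TreeAction.IsWeaklyBranch G)
    (X : Type v) [TopologicalSpace X] [CompactSpace X]
    [MulAction G X] [ContinuousConstSMul G X] [MulAction.IsMinimal G X]
    (Φ : X → Subgroup G)
    (hΦ : TreeAction.LowerSemicontinuousSub Φ) (hΦG : TreeAction.ConjEquivariant Φ) :
    Continuous (fun x => TreeAction.fix (Φ x)) ∧
    ∃ σ : Set.range (fun x => TreeAction.fix (Φ x)) → TreeAction.Antichains T,
      Continuous σ ∧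
      (∀ (g : G) (C : Set.range (fun x => TreeAction.fix (Φ x))),
        ∃ hC : g • C.1 ∈ Set.range (fun x => TreeAction.fix (Φ x)),
          σ ⟨g • C.1, hC⟩ = g • σ C) ∧
      (∀ C, TreeAction.piPerp (σ C) = C.1) ∧
      ∀ x : X, ∀ v ∈ (σ ⟨TreeAction.fix (Φ x), x, rfl⟩).verts,
        ⁅TreeAction.rist G v, TreeAction.rist G v⁆ ≤ Φ x := by
  have := hG.infinite
  obtain ⟨f, hf, hfΦ⟩ := TreeAction.exists_level_function hG
    (TreeAction.exists_covBy hG.locallyFinite hG.levelTransitive) hΦ hΦG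
  refine ⟨TreeAction.continuous_fix hG.locallyFinite hΦ hΦG,
    fun C => TreeAction.refinedComplement f C.1,
    (TreeAction.continuous_refinedComplement hG.locallyFinite f).comp continuous_subtype_val,
    fun g C => ⟨?_, TreeAction.refinedComplement_smul f g C.1⟩,
    fun C => TreeAction.piPerp_refinedComplement hf C.1, ?_⟩
  · obtain ⟨x, hx⟩ := C.2
    exact ⟨g • x, by rw [← hx]; exact TreeAction.fix_smul hΦG g x⟩
  · rintro x u ⟨v, hvu, ⟨n, hn, hu⟩, hv⟩
    exact hfΦ n v hn u hu hvu x hv.1
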